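/- **Quantum query model.** Let $D,K$ be nonempty sets, $F$ a nonempty set of functions $D\to K$, $G$ a normed space, and $S:F\to G$ a mapping. Write $\mathbf{Z}[0,M)=\{0,\dots,M-1\}$, $\mathbf{N}=\{1,2,\dots\}$, and let $H_m=(\mathbf{C}^2)^{\otimes m}$ with canonical basis $\mathcal{C}_m=\{|i\rangle : i\in\mathbf{Z}[0,2^m)\}$. A quantum query is a tuple $Q=(m,m',m'',Z,\tau,\beta)$ with $m,m',m''\in\mathbf{N}$, $m'+m''\le m$, $\emptyset\neq Z\subseteq\mathbf{Z}[0,2^{m'})$, $\tau:Z\to D$ and $\beta:K\to\mathbf{Z}[0,2^{m''})$. For $f\in F$ it defines the unitary operator $Q_f$ on $H_m=H_{m'}\otimes H_{m''}\otimes H_{m-m'-m''}$ by $Q_f|i\rangle|x\rangle|y\rangle=|i\rangle|x\oplus\beta(f(\tau(i)))\rangle|y\rangle$ if $i\in Z$ and $Q_f|i\rangle|x\rangle|y\rangle=|i\rangle|x\rangle|y\rangle$ otherwise, where $\oplus$ is addition modulo $2^{m''}$. A quantum algorithm without measurement is a pair $A=(Q,(U_j)_{j=0}^n)$ with $n\ge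 0$ and arbitrary unitary operators $U_j$ on $H_m$; put $A_f=U_nQ_fU_{n-1}\cdots U_1Q_fU_0$, with matrix entries $A_f(x,y)$ in the canonical basis, and $n_q(A)=n$. A quantum algorithm from $F$ to $G$ with $k\ge1$ measurements is a tuple $A=((A_l)_{l=0}^{k-1},(b_l)_{l=0}^{k-1},\varphi)$, where the $A_l$ are quantum algorithms without measurement, on $m_l$ qubits, $b_0\in\mathbf{Z}[0,2^{m_0})$, $b_l:\prod_{i<l}\mathbf{Z}[0,2^{m_i})\to\mathbf{Z}[0,2^{m_l})$ for $1\le l\le k-1$, and $\varphi:\prod_{l=0}^{k-1}\mathbf{Z}[0,2^{m_l})\to G$. At input $f$ it outputs $\varphi(x_0,\dots,x_{k-1})$ with probability $\prod_{l=0}^{k-1}|A_{l,f}(x_l,b_l(x_0,\dots,x_{l-1}))|^2$; this defines the output distribution $A(f)$ on $G$. Its number of queries is $n_q(A)=\sum_l n_q(A_l)$. With $\zeta$ distributed according to $A(f)$, let $$e(S,A,f)=\inf\{\varepsilon\ge0 : \mathbf{P}\{\|S(f)-\zeta\|>\varepsilon\}\le 1/4\},$$ $$e_n^{\rm q}(S,F)=\inf\Big\{\sup_{f\in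 F}e(S,A,f) : A \text{ a quantum algorithm from } F \text{ to } G \text{ with } n_q(A)\le n\Big\}.$$ **Embeddings.** For $N\in\mathbf{N}$ and $1\le p\le\infty$ let $L_p^N$ be the space of all functions $f:\mathbf{Z}[0,N)\to\mathbf{R}$ with norm $\|f\|=\big(\frac1N\sum_{i=0}^{N-1}|f(i)|^p\big)^{1/p}$ if $p<\infty$ and $\|f\|=\max_i|f(i)|$ if $p=\infty$; let $\mathcal{B}(L_p^N)$ be its closed unit ball, and let $J_{pq}^N:L_p^N\to L_q^N$ be the identity operator $J_{pq}^Nf=f$. Below, $\log=\log_2$ and $1/\infty=2/\infty=0$. **Proposition.** Let $1\le p,q\le\infty$. There are constants $c_0,c_1>0$ (depending only on $p$ and $q$) such that for all $n,N\in\mathbf{N}$ with $n\le c_0N$ the following hold: if $p\le q$, then $$e_n^{\rm q}(J_{pq}^N,\mathcal{B}(L_p^N))\ge c_1\min\left(\Big(\frac Nn\Big)^{2/p-2/q}\big(\log(n/\sqrt N+2)\big)^{-2/q},\;N^{1/p-1/q}\right),$$ and if $p>q$, then $$e_n^{\rm q}(J_{pq}^N,\mathcal{B}(L_p^N))\ge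 c_1(\log N+1)^{-2/q}.$$ -/

import Mathlib

open scoped ENNReal NNReal

/-! ### Quantum algorithms with queries to a function `f : D → K` -/

/-- A quantum query `(m, m', m'', Z, τ, β)`. The qubits are split into `mIdx = m' ≥ 1` index
qubits, `mVal = m'' ≥ 1` value qubits and `mAux = m - m' - m''` further qubits. -/
structure QQuery (D K : Type*) where
  mIdx : ℕ
  mVal : ℕ
  mAux : ℕ
  mIdx_pos : 1 ≤ mIdx
  mVal_pos : 1 ≤ mVal
  Z : Finset (Fin (2 ^ mIdx))
  Z_nonempty : Z.Nonempty
  τ : {i : Fin (2 ^ mIdx) // i ∈ Z} → D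
  β : K → Fin (2 ^ mVal)

namespace QQuery

variable {D K : Type*}

/-- The labels `(i, x, y)` of the canonical basis vectors `|i⟩|x⟩|y⟩` of the state space
`H_m = H_{m'} ⊗ H_{m''} ⊗ H_{m-m'-m''}`. -/
abbrev Idx (Q : QQuery D K) : Type :=
  Fin (2 ^ Q.mIdx) × Fin (2 ^ Q.mVal) × Fin (2 ^ Q.mAux)

/-- The number of qubits. -/
def numQubits (Q : QQuery D K) : ℕ := Q.mIdx + Q.mVal + Q.mAux

/-- The action of the query on basis labels: `(i, x, y)` is sent to `(i, x ⊕ β (f (τ i)), y)` if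
`i ∈ Z` and is fixed otherwise; `⊕` is addition modulo `2 ^ m''` (the addition of `Fin`). -/
def act (Q : QQuery D K) (f : D → K) (v : Q.Idx) : Q.Idx :=
  if h : v.1 ∈ Q.Z then (v.1, v.2.1 + Q.β (f (Q.τ ⟨v.1, h⟩)), v.2.2) else v

/-- The unitary operator `Q_f`, as a matrix in the canonical basis. -/
def mat (Q : QQuery D K) (f : D → K) : Matrix Q.Idx Q.Idx ℂ :=
  Matrix.of fun w v => if w = Q.act f v then 1 else 0

end QQuery

/-- A quantum algorithm with no measurement: a query `Q` and unitaries `U_0, …, U_n`. -/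
structure QCircuit (D K : Type*) where
  Q : QQuery D K
  n : ℕ
  U : Fin (n + 1) → Matrix.unitaryGroup Q.Idx ℂ

/-- The matrix of `A_f = U_n Q_f U_{n-1} ⋯ U_1 Q_f U_0` in the canonical basis. -/
noncomputable def QCircuit.mat {D K : Type*} (A : QCircuit D K) (f : D → K) :
    Matrix A.Q.Idx A.Q.Idx ℂ :=
  Fin.induction (motive := fun _ => Matrix A.Q.Idx A.Q.Idx ℂ)
    (A.U 0 : Matrix A.Q.Idx A.Q.Idx ℂ)
    (fun j M => (A.U j.succ : Matrix A.Q.Idx A.Q.Idx ℂ) * A.Q.mat f * M)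
    (Fin.last A.n)

/-- A quantum algorithm with `k ≥ 1` measurements and outputs in `G`. The initial basis state
`b l` of the `l`-th circuit is a function of the previous measurement results (a constant for
`l = 0`), and the output is the function `φ` of all measurement results. -/
structure QAlgorithm (D K G : Type*) where
  k : ℕ
  k_pos : 1 ≤ k
  A : Fin k → QCircuit D K
  b : (l : Fin k) → ((i : {i : Fin k // i < l}) → (A i.1).Q.Idx) → (A l).Q.Idx
  φ : ((l : Fin k) → (A l).Q.Idx) → G

namespace QAlgorithm

variable {D K G : Type*}

/-- The total number of queries. -/
def numQueries (A : QAlgorithm D K G) : ℕ := ∑ l, (A.A l).n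

/-- The probability `p_{A,f}(x_0, …, x_{k-1})` of the measurement results `x`. -/
noncomputable def prob (A : QAlgorithm D K G) (f : D → K)
    (x : (l : Fin A.k) → (A.A l).Q.Idx) : ℝ :=
  ∏ l, ‖(A.A l).mat f (x l) (A.b l fun i => x i.1)‖ ^ 2

open Classical in
/-- The output distribution `A(f)`, evaluated at a set `C ⊆ G`. -/
noncomputable def output (A : QAlgorithm D K G) (f : D → K) (C : Set G) : ℝ :=
  ∑ x with A.φ x ∈ C, A.prob f x

/-- The error `e(S, A, f, θ)`, the infimum of all `ε ≥ 0` such that the output of `A` at `f` has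
distance more than `ε` from `s = S f` with probability at most `θ`. -/
noncomputable def errorAt [NormedAddCommGroup G] (A : QAlgorithm D K G) (s : G) (f : D → K)
    (θ : ℝ) : ℝ≥0∞ :=
  ⨅ (ε : ℝ≥0) (_ : A.output f {z | (ε : ℝ) < ‖s - z‖} ≤ θ), (ε : ℝ≥0∞)

/-- The error `e(S, A, F, θ) = sup_{f ∈ F} e(S, A, f, θ)`. -/
noncomputable def error [NormedAddCommGroup G] (A : QAlgorithm D K G) {F : Set (D → K)}
    (S : F → G) (θ : ℝ) : ℝ≥0∞ :=
  ⨆ f : F, A.errorAt (S f) f.1 θ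

end QAlgorithm

/-- The minimal query error `e_n^q(S, F, θ)`. -/
noncomputable def minQueryErrorAt {D K G : Type*} [NormedAddCommGroup G] (n : ℕ)
    {F : Set (D → K)} (S : F → G) (θ : ℝ) : ℝ≥0∞ :=
  ⨅ (A : QAlgorithm D K G) (_ : A.numQueries ≤ n), A.error S θ

/-- The `n`-th minimal query error `e_n^q(S, F) = e_n^q(S, F, 1/4)`. -/
noncomputable def minQueryError {D K G : Type*} [NormedAddCommGroup G] (n : ℕ)
    {F : Set (D → K)} (S : F → G) : ℝ≥0∞ :=
  minQueryErrorAt n S (1 / 4)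

/-! ### The spaces `L_p^N` and their embeddings -/

/-- The normalized norm of `L_p^N`. -/
noncomputable def lpNNorm (p : ℝ≥0∞) {N : ℕ} (f : Fin N → ℝ) : ℝ :=
  if p = ∞ then ⨆ i, |f i|
  else (1 / (N : ℝ) * ∑ i, |f i| ^ p.toReal) ^ (1 / p.toReal)

theorem lpNNorm_eq (p : ℝ≥0∞) [hp : Fact (1 ≤ p)] {N : ℕ} (f : Fin N → ℝ) :
    lpNNorm p f = (N : ℝ) ^ (-(1 / p.toReal)) * ‖WithLp.toLp p f‖ := by
  unfold lpNNorm
  split_ifs with h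
  · subst h
    simp [PiLp.norm_eq_ciSup]
  · have hpos : 0 < p.toReal :=
      ENNReal.toReal_pos (zero_lt_one.trans_le hp.out).ne' h
    rw [PiLp.norm_eq_sum hpos, Real.mul_rpow (by positivity) (by positivity), one_div (N : ℝ),
      Real.inv_rpow (by positivity), Real.rpow_neg (by positivity)]
    simp

theorem lpNNorm_zero (p : ℝ≥0∞) [Fact (1 ≤ p)] (N : ℕ) :
    lpNNorm p (0 : Fin N → ℝ) = 0 := by
  rw [lpNNorm_eq]
  simp

theorem lpNNorm_add_le (p : ℝ≥0∞) [Fact (1 ≤ p)] {N : ℕ} (f g : Fin N → ℝ) :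
    lpNNorm p (f + g) ≤ lpNNorm p f + lpNNorm p g := by
  simp only [lpNNorm_eq]
  rw [← mul_add, WithLp.toLp_add]
  exact mul_le_mul_of_nonneg_left (norm_add_le _ _) (by positivity)

theorem lpNNorm_smul (p : ℝ≥0∞) [Fact (1 ≤ p)] {N : ℕ} (c : ℝ) (f : Fin N → ℝ) :
    lpNNorm p (c • f) = ‖c‖ * lpNNorm p f := by
  simp only [lpNNorm_eq]
  rw [WithLp.toLp_smul, norm_smul, mul_left_comm]

theorem lpNNorm_neg (p : ℝ≥0∞) [Fact (1 ≤ p)] {N : ℕ} (f : Fin N → ℝ) :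
    lpNNorm p (-f) = lpNNorm p f := by
  simp only [lpNNorm_eq]
  rw [WithLp.toLp_neg, norm_neg]

theorem eq_zero_of_lpNNorm_eq_zero (p : ℝ≥0∞) [Fact (1 ≤ p)] {N : ℕ} (f : Fin N → ℝ)
    (hf : lpNNorm p f = 0) : f = 0 := by
  rw [lpNNorm_eq] at hf
  funext i
  have hN : (0 : ℝ) < N := by exact_mod_cast i.pos
  rcases mul_eq_zero.1 hf with h | h
  · exact absurd h (Real.rpow_pos_of_pos hN _).ne'
  · rw [norm_eq_zero] at h
    exact congrFun (congrArg WithLp.ofLp h) i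

/-- The space `L_p^N` of all functions `{0, …, N-1} → ℝ`, with the normalized norm. -/
def LpN (_p : ℝ≥0∞) (N : ℕ) : Type := Fin N → ℝ

instance (p : ℝ≥0∞) (N : ℕ) : AddCommGroup (LpN p N) :=
  inferInstanceAs (AddCommGroup (Fin N → ℝ))

noncomputable instance (p : ℝ≥0∞) (N : ℕ) : Module ℝ (LpN p N) :=
  inferInstanceAs (Module ℝ (Fin N → ℝ))

noncomputable instance (p : ℝ≥0∞) [Fact (1 ≤ p)] (N : ℕ) : NormedAddCommGroup (LpN p N) :=
  AddGroupNorm.toNormedAddCommGroup (E := LpN p N)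
    { toFun := fun f => lpNNorm p (N := N) f
      map_zero' := lpNNorm_zero p N
      add_le' := fun f g => lpNNorm_add_le p (N := N) f g
      neg' := fun f => lpNNorm_neg p (N := N) f
      eq_zero_of_map_eq_zero' := fun f hf => eq_zero_of_lpNNorm_eq_zero p (N := N) f hf }

theorem LpN.norm_def (p : ℝ≥0∞) [Fact (1 ≤ p)] {N : ℕ} (f : LpN p N) :
    ‖f‖ = lpNNorm p (N := N) f := rfl

noncomputable instance (p : ℝ≥0∞) [Fact (1 ≤ p)] (N : ℕ) : NormedSpace ℝ (LpN p N) where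
  norm_smul_le c f := (lpNNorm_smul p (N := N) c f).le

/-- The identity operator `J_{pq}^N : L_p^N → L_q^N`. -/
noncomputable def embJ (p q : ℝ≥0∞) (N : ℕ) : LpN p N →ₗ[ℝ] LpN q N where
  toFun f := f
  map_add' _ _ := rfl
  map_smul' _ _ := rfl

/-- The unit ball of `L_p^N`, as a set of functions on `{0, …, N-1}`. -/
def ballLpN (p : ℝ≥0∞) [Fact (1 ≤ p)] (N : ℕ) : Set (Fin N → ℝ) :=
  {f | ‖(show LpN p N from f)‖ ≤ 1}

/-- The restriction of `J_{pq}^N` to the unit ball of `L_p^N`. -/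
noncomputable def embJBall (p q : ℝ≥0∞) [Fact (1 ≤ p)] (N : ℕ) (f : ballLpN p N) : LpN q N :=
  embJ p q N f.1

/-! The bound comes from a weighted adversary argument. Cut `M * B ≤ N` positions into `M` blocks of
length `B` and consider inputs having in each block at most one entry `h = (N/M)^(1/p)`, all other
entries being zero; they lie in the unit ball of `L_p^N`. An output with `L_q` error below `(1/96)
(N/M)^(1/p-1/q)` is off by at least `h/2` at no more than `M/48` positions, so it almost recovers
the pattern of marked positions.

Pair each pattern with those obtained by erasing one mark, and measure progress by the weighted sum
of `‖1 - ⟨ψ_x, ψ_y⟩‖` over the pairs. It starts at `0`. With weights balancing one empty block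
against its `B` marked versions, a query adds at most `2/√B` times the total weight
(`Adversary.Progress.query`), and intermediate measurements cost nothing
(`Adversary.Progress.bind`). Recovery of the pattern forces progress `M/32` times the total weight
(`Adversary.Progress.le_of_recovers`). Hence fewer than `M√B/64` queries do not suffice
(`le_minQueryError_embJBall`).

For `p ≤ q` take `M` of order `max(n²/N, 1)` and `B = ⌊N/M⌋`; for `p > q` take `M = N`, `B = 1`.
Both bounds come out without logarithms. The logarithmic factors of the statement are at most `1`.
-/

/-! ### Weighted adversaries and progress under successive measurements. -/

/-- A weighted adversary: pairs `r` of inputs that differ only at the position `pos r`. -/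
structure Adversary (D K Ω R : Type*) where
  input : Ω → D → K
  left : R → Ω
  right : R → Ω
  pos : R → D
  μ : Ω → ℝ
  w : R → ℝ
  κ : ℝ
  μ_nonneg : ∀ x, 0 ≤ μ x
  w_nonneg : ∀ r, 0 ≤ w r
  κ_nonneg : 0 ≤ κ
  -- Each input occurs at most once per position on either side, so the query magnitudes charged to
  -- it sum to at most 1.
  left_inj : Function.Injective fun r => (left r, pos r)
  right_inj : Function.Injective fun r => (right r, pos r)
  agree : ∀ r d, d ≠ pos r → input (left r) d = input (right r) d
  w_le : ∀ r, w r ≤ κ * √(μ (left r) * μ (right r))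

namespace Adversary

open ComplexConjugate

variable {D K Ω R : Type*} [Fintype Ω] [Fintype R]

/-- The states `ψ x` are normalized, and the weighted progress in distinguishing the pairs of the
adversary, for states scaled by arbitrary factors `α x`, is at most `c`. -/
structure Progress (𝒜 : Adversary D K Ω R) {ι : Type*} [Fintype ι] (ψ : Ω → ι → ℂ) (c : ℝ) :
    Prop where
  norm_eq : ∀ x, ∑ v, ‖ψ x v‖ ^ 2 = 1
  -- The bound is required for all scalings because a measurement result `i` leaves the branch of
  -- input `x` with factor `‖ψ x i‖`.
  le : ∀ α : Ω → ℝ, (∀ x, 0 ≤ α x) →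
    ∑ r, 𝒜.w r * (α (𝒜.left r) * α (𝒜.right r)) *
      ‖1 - ∑ v, ψ (𝒜.left r) v * conj (ψ (𝒜.right r) v)‖ ≤ c * ∑ x, 𝒜.μ x * α x ^ 2

variable {𝒜 : Adversary D K Ω R}

theorem Progress.congr_equiv {ι ι' : Type*} [Fintype ι] [Fintype ι'] {ψ : Ω → ι → ℂ} {c : ℝ}
    (h : 𝒜.Progress ψ c) (e : ι' ≃ ι) : 𝒜.Progress (fun x v => ψ x (e v)) c where
  norm_eq x := by rw [← h.norm_eq x, ← e.sum_comp]
  le α hα := by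
    convert h.le α hα using 6 with r _
    exact e.sum_comp fun v => ψ (𝒜.left r) v * conj (ψ (𝒜.right r) v)

/-- Progress is additive under a further stage that depends on a measurement. -/
theorem Progress.bind {ι ι' : Type*} [Fintype ι] [Fintype ι'] {ψ : Ω → ι → ℂ}
    {χ : ι → Ω → ι' → ℂ} {c c' : ℝ} (h : 𝒜.Progress ψ c) (h' : ∀ i, 𝒜.Progress (χ i) c') :
    𝒜.Progress (fun x (v : ι × ι') => ψ x v.1 * χ v.1 x v.2) (c + c') where
  norm_eq x := by
    rw [← h.norm_eq x, Fintype.sum_prod_type]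
    refine Finset.sum_congr rfl fun i _ => ?_
    simp only [norm_mul, mul_pow, ← Finset.mul_sum, (h' i).norm_eq, mul_one]
  le α hα := by
    have key : ∀ r, ‖1 - ∑ v : ι × ι', ψ (𝒜.left r) v.1 * χ v.1 (𝒜.left r) v.2 *
          conj (ψ (𝒜.right r) v.1 * χ v.1 (𝒜.right r) v.2)‖ ≤
        ‖1 - ∑ v, ψ (𝒜.left r) v * conj (ψ (𝒜.right r) v)‖ +
        ∑ i, (‖ψ (𝒜.left r) i‖ * ‖ψ (𝒜.right r) i‖) *
          ‖1 - ∑ v, χ i (𝒜.left r) v * conj (χ i (𝒜.right r) v)‖ := by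
      intro r
      -- The defect of the inner product splits into that of the first stage and, for each result
      -- `i`, that of the second stage scaled by the amplitudes of `i`.
      have : 1 - ∑ v : ι × ι', ψ (𝒜.left r) v.1 * χ v.1 (𝒜.left r) v.2 *
          conj (ψ (𝒜.right r) v.1 * χ v.1 (𝒜.right r) v.2) =
          (1 - ∑ v, ψ (𝒜.left r) v * conj (ψ (𝒜.right r) v)) +
          ∑ i, (ψ (𝒜.left r) i * conj (ψ (𝒜.right r) i)) *
          (1 - ∑ v, χ i (𝒜.left r) v * conj (χ i (𝒜.right r) v)) := by
        simp only [mul_sub, mul_one, Finset.sum_sub_distrib, Fintype.sum_prod_type,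
          Finset.mul_sum, map_mul]
        rw [sub_add_sub_cancel]
        congr 1
        refine Finset.sum_congr rfl fun i _ => Finset.sum_congr rfl fun j _ => ?_
        ring
      rw [this]
      refine (norm_add_le _ _).trans (add_le_add_right ((norm_sum_le _ _).trans ?_) _)
      simp
    calc _ ≤ ∑ r, (𝒜.w r * (α (𝒜.left r) * α (𝒜.right r)) *
            ‖1 - ∑ v, ψ (𝒜.left r) v * conj (ψ (𝒜.right r) v)‖ +
          ∑ i, 𝒜.w r * ((α (𝒜.left r) * ‖ψ (𝒜.left r) i‖) * (α (𝒜.right r) * ‖ψ (𝒜.right r) i‖)) *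
            ‖1 - ∑ v, χ i (𝒜.left r) v * conj (χ i (𝒜.right r) v)‖) := by
          refine Finset.sum_le_sum fun r _ => ?_
          have h0 : 0 ≤ 𝒜.w r * (α (𝒜.left r) * α (𝒜.right r)) :=
            mul_nonneg (𝒜.w_nonneg r) (mul_nonneg (hα _) (hα _))
          refine (mul_le_mul_of_nonneg_left (key r) h0).trans (le_of_eq ?_)
          rw [mul_add, Finset.mul_sum]
          congr 1
          refine Finset.sum_congr rfl fun i _ => ?_
          ring
      _ ≤ c * ∑ x, 𝒜.μ x * α x ^ 2 + ∑ i, c' * ∑ x, 𝒜.μ x * (α x * ‖ψ x i‖) ^ 2 := by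
          rw [Finset.sum_add_distrib, Finset.sum_comm]
          refine add_le_add (h.le α hα) (Finset.sum_le_sum fun i _ => ?_)
          -- The amplitudes of `i` are absorbed into the scaling; summed over `i`, their squares
          -- give back `α x ^ 2`.
          exact (h' i).le (fun x => α x * ‖ψ x i‖) fun x => mul_nonneg (hα x) (norm_nonneg _)
      _ = _ := by
          rw [add_mul, ← Finset.mul_sum, Finset.sum_comm]
          congr 2
          refine Finset.sum_congr rfl fun x _ => ?_
          simp only [mul_pow, ← Finset.mul_sum, h.norm_eq, mul_one]

/-- Progress of a protocol with `k` successive measurements. -/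
theorem Progress.prod {k : ℕ} {X : Fin k → Type*} [∀ l, Fintype (X l)] [∀ l, Nonempty (X l)]
    (a : Ω → (l : Fin k) → (∀ i, X i) → ℂ) (c : Fin k → ℝ)
    (dep : ∀ x l z z', (∀ i ≤ l, z i = z' i) → a x l z = a x l z')
    (h : ∀ l z, 𝒜.Progress (fun x v => a x l (Function.update z l v)) (c l)) :
    𝒜.Progress (fun x z => ∏ l, a x l z) (∑ l, c l) := by
  induction k with
  | zero => exact ⟨fun x => by simp, fun α _ => by simp⟩
  | succ k ih =>
    obtain ⟨z₀⟩ : Nonempty (∀ i, X i) := inferInstance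
    have h0 : 𝒜.Progress (fun x v => a x 0 (Fin.cons v (Fin.tail z₀))) (c 0) := by
      convert h 0 z₀ using 4 with x v
      conv_rhs => rw [← Fin.cons_self_tail z₀, Fin.update_cons_zero]
    have h1 : ∀ v : X 0, 𝒜.Progress
        (fun x z => ∏ l : Fin k, a x l.succ (Fin.cons v z)) (∑ l : Fin k, c l.succ) := by
      intro v
      refine ih (fun x l z => a x l.succ (Fin.cons v z)) (fun l => c l.succ) ?_ ?_
      · intro x l z z' hz
        refine dep _ _ _ _ fun i hi => ?_
        induction i using Fin.cases with
        | zero => rfl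
        | succ i => simpa using hz i (Fin.succ_le_succ_iff.1 hi)
      · intro l z
        simpa only [Fin.cons_update] using h l.succ (Fin.cons v z)
    have := (h0.bind h1).congr_equiv (Fin.consEquiv X).symm
    rw [Fin.sum_univ_succ]
    convert this using 3 with x z
    rw [Fin.prod_univ_succ]
    congr 1
    · refine dep _ _ _ _ fun i hi => ?_
      obtain rfl : i = 0 := Fin.le_zero_iff.1 hi
      simp [Fin.consEquiv]
    · refine Finset.prod_congr rfl fun l _ => ?_
      congr 1
      exact (Fin.cons_self_tail z).symm

end Adversary

/-! ### The effect of one query on inner products. -/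

namespace QQuery

variable {D K : Type*} (Q : QQuery D K) (f g : D → K)

theorem act_injective : Function.Injective (Q.act f) := by
  rintro ⟨i, x, y⟩ ⟨i', x', y'⟩ h
  have hi : i = i' := by
    have := congrArg Prod.fst h
    unfold act at this
    split_ifs at this <;> exact this
  subst hi
  unfold act at h
  split_ifs at h with hz
  · simpa using h
  · exact h

theorem act_fst (v : Q.Idx) : (Q.act f v).1 = v.1 := by
  unfold act; split_ifs <;> rfl

/-- The action of a query as a permutation of the labels. -/
noncomputable def actEquiv : Q.Idx ≃ Q.Idx :=
  Equiv.ofBijective _ (Finite.injective_iff_bijective.1 (Q.act_injective f))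

theorem mat_mulVec (ψ : Q.Idx → ℂ) (v : Q.Idx) : (Q.mat f).mulVec ψ (Q.actEquiv f v) = ψ v := by
  have : ∀ u, Q.actEquiv f v = Q.act f u ↔ v = u := fun u =>
    (Q.act_injective f).eq_iff (a := v)
  simp [Matrix.mulVec, dotProduct, mat, this]

/-- The labels at which the query evaluates the input at `d`. -/
def asks (d : D) (v : Q.Idx) : Prop := ∃ h : v.1 ∈ Q.Z, Q.τ ⟨v.1, h⟩ = d

theorem asks_congr {d : D} {v v' : Q.Idx} (h : v.1 = v'.1) : Q.asks d v ↔ Q.asks d v' := by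
  unfold asks; rw [h]

variable {f g} in
theorem act_eq_of_not_asks {d : D} (hfg : ∀ d', d' ≠ d → f d' = g d') {v : Q.Idx}
    (hv : ¬ Q.asks d v) : Q.act f v = Q.act g v := by
  unfold act
  split_ifs with h
  · rw [hfg _ fun h' => hv ⟨h, h'⟩]
  · rfl

open Classical in
/-- The query magnitude of the state `ψ` at `d`. -/
noncomputable def magnitude (ψ : Q.Idx → ℂ) (d : D) : ℝ := ∑ v with Q.asks d v, ‖ψ v‖ ^ 2

theorem magnitude_nonneg (ψ : Q.Idx → ℂ) (d : D) : 0 ≤ Q.magnitude ψ d :=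
  Finset.sum_nonneg fun _ _ => sq_nonneg _

open Classical in
theorem sum_magnitude_le (ψ : Q.Idx → ℂ) (s : Finset D) :
    ∑ d ∈ s, Q.magnitude ψ d ≤ ∑ v, ‖ψ v‖ ^ 2 := by
  unfold magnitude
  rw [← Finset.sum_biUnion]
  · exact Finset.sum_le_sum_of_subset_of_nonneg (Finset.subset_univ _) fun _ _ _ => sq_nonneg _
  · intro d _ d' _ hd
    refine Finset.disjoint_filter.2 fun v _ h h' => hd ?_
    obtain ⟨_, rfl⟩ := h
    exact h'.2

open ComplexConjugate

-- At labels that do not ask for `d` both queries are the same permutation, so those parts of the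
-- two inner products cancel. Cauchy–Schwarz bounds each of the two remaining parts; a query
-- permutes the labels asking for `d` among themselves, so it preserves the magnitude.
open Classical in
theorem norm_inner_sub_le {d : D} (hfg : ∀ d', d' ≠ d → f d' = g d') (ψ χ : Q.Idx → ℂ) :
    ‖∑ v, ψ v * conj (χ v) - ∑ v, (Q.mat f).mulVec ψ v * conj ((Q.mat g).mulVec χ v)‖ ≤
      2 * √(Q.magnitude ψ d * Q.magnitude χ d) := by
  have cs : ∀ (φ φ' : Q.Idx → ℂ) (s : Finset Q.Idx), ‖∑ v ∈ s, φ v * conj (φ' v)‖ ≤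
      √((∑ v ∈ s, ‖φ v‖ ^ 2) * ∑ v ∈ s, ‖φ' v‖ ^ 2) := by
    intro φ φ' s
    refine (norm_sum_le _ _).trans (Real.le_sqrt_of_sq_le ?_)
    simpa using Finset.sum_mul_sq_le_sq_mul_sq s (fun v => ‖φ v‖) fun v => ‖φ' v‖
  have re : ∀ (f : D → K) (F : Q.Idx → ℂ) , ∑ v with ¬ Q.asks d v, F v =
      ∑ v with ¬ Q.asks d v, F (Q.actEquiv f v) := by
    intro f F
    refine (Finset.sum_equiv (Q.actEquiv f) (fun v => ?_) fun v _ => rfl).symm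
    simpa using not_congr (Q.asks_congr (v' := Q.actEquiv f v) (Q.act_fst f v).symm)
  have mag : ∀ (f : D → K) (φ : Q.Idx → ℂ), ∑ v with Q.asks d v, ‖(Q.mat f).mulVec φ v‖ ^ 2 =
      Q.magnitude φ d := by
    intro f φ
    refine (Finset.sum_equiv (Q.actEquiv f) (fun v => ?_) fun v _ => ?_).symm
    · simpa using Q.asks_congr (v' := Q.actEquiv f v) (Q.act_fst f v).symm
    · rw [Q.mat_mulVec]
  rw [← Finset.sum_filter_add_sum_filter_not _ (Q.asks d),
    ← Finset.sum_filter_add_sum_filter_not (f := fun v => (Q.mat f).mulVec ψ v * _) _ (Q.asks d)]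
  have off : ∑ v with ¬ Q.asks d v, (Q.mat f).mulVec ψ v * conj ((Q.mat g).mulVec χ v) =
      ∑ v with ¬ Q.asks d v, ψ v * conj (χ v) := by
    rw [re f]
    refine Finset.sum_congr rfl fun v hv => ?_
    have : Q.actEquiv f v = Q.actEquiv g v := Q.act_eq_of_not_asks hfg (Finset.mem_filter.1 hv).2
    rw [Q.mat_mulVec, this, Q.mat_mulVec]
  rw [off, add_sub_add_right_eq_sub, two_mul]
  refine (norm_sub_le _ _).trans (add_le_add (cs _ _ _) ((cs _ _ _).trans ?_))
  rw [mag, mag]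

theorem sum_norm_mat_mulVec (ψ : Q.Idx → ℂ) :
    ∑ v, ‖(Q.mat f).mulVec ψ v‖ ^ 2 = ∑ v, ‖ψ v‖ ^ 2 := by
  rw [← (Q.actEquiv f).sum_comp]
  simp only [Q.mat_mulVec]

end QQuery

/-! ### Progress along a circuit. -/

namespace Adversary

open ComplexConjugate

theorem unitary_inner {ι : Type*} [Fintype ι] [DecidableEq ι] (U : Matrix.unitaryGroup ι ℂ)
    (ψ χ : ι → ℂ) :
    ∑ v, (U.1.mulVec ψ) v * conj ((U.1.mulVec χ) v) = ∑ v, ψ v * conj (χ v) := by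
  have h : star (U.1.mulVec χ) ⬝ᵥ U.1.mulVec ψ = star χ ⬝ᵥ ψ := by
    rw [Matrix.star_mulVec, Matrix.dotProduct_mulVec, Matrix.vecMul_vecMul,
      ← Matrix.star_eq_conjTranspose, Matrix.mem_unitaryGroup_iff'.1 U.2, Matrix.vecMul_one]
  simpa [dotProduct, mul_comm] using h

theorem unitary_norm {ι : Type*} [Fintype ι] [DecidableEq ι] (U : Matrix.unitaryGroup ι ℂ)
    (ψ : ι → ℂ) : ∑ v, ‖(U.1.mulVec ψ) v‖ ^ 2 = ∑ v, ‖ψ v‖ ^ 2 := by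
  have := unitary_inner U ψ ψ
  simp only [Complex.mul_conj, Complex.normSq_eq_norm_sq] at this
  exact_mod_cast this

variable {D K Ω R : Type*} [Fintype Ω] [Fintype R] {𝒜 : Adversary D K Ω R}

theorem Progress.unitary {ι : Type*} [Fintype ι] [DecidableEq ι] {ψ : Ω → ι → ℂ} {c : ℝ}
    (h : 𝒜.Progress ψ c) (U : Matrix.unitaryGroup ι ℂ) :
    𝒜.Progress (fun x => U.1.mulVec (ψ x)) c where
  norm_eq x := by rw [unitary_norm, h.norm_eq]
  le α hα := by simpa only [unitary_inner] using h.le α hα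

/-- By injectivity, the pairs containing a given input have distinct positions, and the magnitudes
of a unit vector at distinct positions sum to at most 1. -/
theorem sum_magnitude_le (Q : QQuery D K) (ψ : Ω → Q.Idx → ℂ) (hψ : ∀ x, ∑ v, ‖ψ x v‖ ^ 2 = 1)
    (𝒜 : Adversary D K Ω R) (α : Ω → ℝ) (side : R → Ω)
    (inj : Function.Injective fun r => (side r, 𝒜.pos r)) :
    ∑ r, 𝒜.μ (side r) * α (side r) ^ 2 * Q.magnitude (ψ (side r)) (𝒜.pos r) ≤
      ∑ x, 𝒜.μ x * α x ^ 2 := by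
  classical
  have h0 : ∀ x, 0 ≤ 𝒜.μ x * α x ^ 2 := fun x => mul_nonneg (𝒜.μ_nonneg x) (sq_nonneg _)
  calc _ = ∑ t ∈ Finset.univ.image fun r => (side r, 𝒜.pos r),
        𝒜.μ t.1 * α t.1 ^ 2 * Q.magnitude (ψ t.1) t.2 := by
        rw [Finset.sum_image inj.injOn]
    _ ≤ ∑ t ∈ Finset.univ ×ˢ Finset.univ.image 𝒜.pos,
        𝒜.μ t.1 * α t.1 ^ 2 * Q.magnitude (ψ t.1) t.2 := by
        refine Finset.sum_le_sum_of_subset_of_nonneg ?_ fun t _ _ =>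
          mul_nonneg (h0 _) (Q.magnitude_nonneg _ _)
        intro t ht
        simp only [Finset.mem_image, Finset.mem_univ, true_and] at ht
        obtain ⟨r, rfl⟩ := ht
        simp
    _ ≤ _ := by
        rw [Finset.sum_product]
        refine Finset.sum_le_sum fun x _ => ?_
        simp only [← Finset.mul_sum]
        have := Q.sum_magnitude_le (ψ x) (Finset.univ.image 𝒜.pos)
        rw [hψ] at this
        exact mul_le_of_le_one_right (h0 x) this

/-- The change of the inner product is at most twice a geometric mean of query magnitudes. With `w ≤
κ √(μ μ')` and `2AC ≤ A² + C²` it separates into a left and a right sum, each bounded by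
`sum_magnitude_le`. -/
theorem Progress.query {Q : QQuery D K} {ψ : Ω → Q.Idx → ℂ} {c : ℝ} (h : 𝒜.Progress ψ c) :
    𝒜.Progress (fun x => (Q.mat (𝒜.input x)).mulVec (ψ x)) (c + 2 * 𝒜.κ) where
  norm_eq x := by rw [Q.sum_norm_mat_mulVec, h.norm_eq]
  le α hα := by
    set m : Ω → D → ℝ := fun x d => Q.magnitude (ψ x) d with hm
    have hm0 : ∀ x d, 0 ≤ m x d := fun x d => Q.magnitude_nonneg _ _
    have key : ∀ r, 𝒜.w r * (α (𝒜.left r) * α (𝒜.right r)) *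
        (2 * √(m (𝒜.left r) (𝒜.pos r) * m (𝒜.right r) (𝒜.pos r))) ≤
        𝒜.κ * (𝒜.μ (𝒜.left r) * α (𝒜.left r) ^ 2 * m (𝒜.left r) (𝒜.pos r)) +
        𝒜.κ * (𝒜.μ (𝒜.right r) * α (𝒜.right r) ^ 2 * m (𝒜.right r) (𝒜.pos r)) := by
      intro r
      have hx := 𝒜.μ_nonneg (𝒜.left r)
      have hy := 𝒜.μ_nonneg (𝒜.right r)
      have hmx := hm0 (𝒜.left r) (𝒜.pos r)
      have hmy := hm0 (𝒜.right r) (𝒜.pos r)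
      have hw := 𝒜.w_le r
      rw [Real.sqrt_mul hx] at hw
      rw [Real.sqrt_mul hmx]
      have hp : 0 ≤ (α (𝒜.left r) * α (𝒜.right r)) * (2 * (√(m (𝒜.left r) (𝒜.pos r)) *
        √(m (𝒜.right r) (𝒜.pos r)))) := mul_nonneg (mul_nonneg (hα _) (hα _)) (by positivity)
      have e1 := Real.sq_sqrt hx
      have e2 := Real.sq_sqrt hy
      have e3 := Real.sq_sqrt hmx
      have e4 := Real.sq_sqrt hmy
      set A := √(𝒜.μ (𝒜.left r)) * α (𝒜.left r) * √(m (𝒜.left r) (𝒜.pos r)) with hA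
      set C := √(𝒜.μ (𝒜.right r)) * α (𝒜.right r) * √(m (𝒜.right r) (𝒜.pos r)) with hC
      have eA : 𝒜.μ (𝒜.left r) * α (𝒜.left r) ^ 2 * m (𝒜.left r) (𝒜.pos r) = A ^ 2 := by
        rw [hA, mul_pow, mul_pow, e1, e3]
      have eC : 𝒜.μ (𝒜.right r) * α (𝒜.right r) ^ 2 * m (𝒜.right r) (𝒜.pos r) = C ^ 2 := by
        rw [hC, mul_pow, mul_pow, e2, e4]
      rw [eA, eC, mul_assoc]
      refine (mul_le_mul_of_nonneg_right hw hp).trans ?_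
      calc _ = 𝒜.κ * (2 * A * C) := by rw [hA, hC]; ring
        _ ≤ 𝒜.κ * (A ^ 2 + C ^ 2) :=
          mul_le_mul_of_nonneg_left (two_mul_le_add_sq A C) 𝒜.κ_nonneg
        _ = _ := mul_add _ _ _
    have hstep : ∀ r, ‖1 - ∑ v, (Q.mat (𝒜.input (𝒜.left r))).mulVec (ψ (𝒜.left r)) v *
          conj ((Q.mat (𝒜.input (𝒜.right r))).mulVec (ψ (𝒜.right r)) v)‖ ≤
        ‖1 - ∑ v, ψ (𝒜.left r) v * conj (ψ (𝒜.right r) v)‖ +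
          2 * √(m (𝒜.left r) (𝒜.pos r) * m (𝒜.right r) (𝒜.pos r)) := by
      intro r
      refine (norm_sub_le_norm_sub_add_norm_sub _ _ _).trans (add_le_add_right
        (Q.norm_inner_sub_le _ _ (𝒜.agree r) _ _) _)
    calc _ ≤ ∑ r, (𝒜.w r * (α (𝒜.left r) * α (𝒜.right r)) *
            ‖1 - ∑ v, ψ (𝒜.left r) v * conj (ψ (𝒜.right r) v)‖ +
          (𝒜.κ * (𝒜.μ (𝒜.left r) * α (𝒜.left r) ^ 2 * m (𝒜.left r) (𝒜.pos r)) +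
          𝒜.κ * (𝒜.μ (𝒜.right r) * α (𝒜.right r) ^ 2 * m (𝒜.right r) (𝒜.pos r)))) := by
          refine Finset.sum_le_sum fun r _ => ?_
          have h0 : 0 ≤ 𝒜.w r * (α (𝒜.left r) * α (𝒜.right r)) :=
            mul_nonneg (𝒜.w_nonneg r) (mul_nonneg (hα _) (hα _))
          refine (mul_le_mul_of_nonneg_left (hstep r) h0).trans ?_
          rw [mul_add]
          exact add_le_add_right (key r) _
      _ ≤ c * ∑ x, 𝒜.μ x * α x ^ 2 + (𝒜.κ * ∑ x, 𝒜.μ x * α x ^ 2 +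
          𝒜.κ * ∑ x, 𝒜.μ x * α x ^ 2) := by
          rw [Finset.sum_add_distrib, Finset.sum_add_distrib, ← Finset.mul_sum, ← Finset.mul_sum]
          refine add_le_add (h.le α hα) (add_le_add ?_ ?_)
          · exact mul_le_mul_of_nonneg_left
              (sum_magnitude_le Q ψ h.norm_eq 𝒜 α _ 𝒜.left_inj) 𝒜.κ_nonneg
          · exact mul_le_mul_of_nonneg_left
              (sum_magnitude_le Q ψ h.norm_eq 𝒜 α _ 𝒜.right_inj) 𝒜.κ_nonneg
      _ = _ := by ring

theorem progress_const {ι : Type*} [Fintype ι] [DecidableEq ι] (b : ι) :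
    𝒜.Progress (fun _ => Pi.single b 1) 0 where
  norm_eq x := by simp [Pi.single_apply, apply_ite]
  le α hα := by simp [Pi.single_apply, apply_ite]

theorem progress_circuit (A : QCircuit D K) (b : A.Q.Idx) :
    𝒜.Progress (fun x v => A.mat (𝒜.input x) v b) (2 * 𝒜.κ * A.n) := by
  have key : ∀ j : Fin (A.n + 1), 𝒜.Progress (fun x => (Fin.induction
      (motive := fun _ => Matrix A.Q.Idx A.Q.Idx ℂ) (A.U 0 : Matrix A.Q.Idx A.Q.Idx ℂ)
      (fun j M => (A.U j.succ : Matrix A.Q.Idx A.Q.Idx ℂ) * A.Q.mat (𝒜.input x) * M) j).mulVec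
      (Pi.single b 1)) (2 * 𝒜.κ * (j : ℕ)) := by
    intro j
    induction j using Fin.induction with
    | zero => simpa using (progress_const b).unitary (A.U 0)
    | succ j ih =>
      have := ih.query.unitary (A.U j.succ)
      simp only [Fin.induction_succ, ← Matrix.mulVec_mulVec]
      convert this using 1
      simp
      ring
  have := key (Fin.last A.n)
  simp only [Matrix.mulVec_single_one, Fin.val_last] at this
  exact this

end Adversary

/-! ### Algorithms with measurements as a single unit vector of amplitudes. -/

namespace QAlgorithm

variable {D K G : Type*}

/-- The amplitude of the sequence `z` of measurement results. -/
noncomputable def amplitude (A : QAlgorithm D K G) (f : D → K) (z : (l : Fin A.k) → (A.A l).Q.Idx) :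
    ℂ :=
  ∏ l, (A.A l).mat f (z l) (A.b l fun i => z i.1)

theorem prob_eq (A : QAlgorithm D K G) (f : D → K) (z : (l : Fin A.k) → (A.A l).Q.Idx) :
    A.prob f z = ‖A.amplitude f z‖ ^ 2 := by
  simp [prob, amplitude, Finset.prod_pow]

/-- The amplitudes of whole result sequences form a unit vector, as if all measurements were
deferred to the end, so the query costs of the stages add up. -/
theorem progress {Ω R : Type*} [Fintype Ω] [Fintype R] (𝒜 : Adversary D K Ω R)
    (A : QAlgorithm D K G) :
    𝒜.Progress (fun x => A.amplitude (𝒜.input x)) (2 * 𝒜.κ * A.numQueries) := by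
  have := Adversary.Progress.prod (𝒜 := 𝒜) (X := fun l => (A.A l).Q.Idx)
    (fun x l z => (A.A l).mat (𝒜.input x) (z l) (A.b l fun i => z i.1))
    (fun l => 2 * 𝒜.κ * (A.A l).n) ?_ ?_
  · rw [← Finset.mul_sum] at this
    simp only [numQueries, Nat.cast_sum]
    exact this
  · intro x l z z' h
    have : (fun i : {i : Fin A.k // i < l} => z i.1) = fun i : {i : Fin A.k // i < l} => z' i.1 :=
      funext fun i => h _ i.2.le
    simp only [h l le_rfl, this]
  · intro l z
    have h0 : ∀ v, (fun i : {i : Fin A.k // i < l} => Function.update z l v i.1) =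
        fun i : {i : Fin A.k // i < l} => z i.1 :=
      fun v => funext fun i => Function.update_of_ne i.2.ne _ _
    simpa only [h0, Function.update_self] using
      Adversary.progress_circuit (𝒜 := 𝒜) (A.A l) (A.b l fun i => z i.1)

end QAlgorithm

/-! ### Distinguishing two states forces a small inner product. -/

-- `E` plays the role of a test that should hold for `a` and fail for `b`. By weighted AM–GM,
-- `‖a‖‖b‖` is at most `‖a‖²/4 + ‖b‖²` on `E` and `‖a‖² + ‖b‖²/4` off it, so only the error
-- probabilities enter with more than weight `1/4`.
open ComplexConjugate in
theorem half_sub_le_norm_one_sub_inner {ι : Type*} [Fintype ι] (a b : ι → ℂ)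
    (ha : ∑ v, ‖a v‖ ^ 2 = 1) (hb : ∑ v, ‖b v‖ ^ 2 = 1) (E : ι → Prop) [DecidablePred E] :
    1 / 2 - 3 / 4 * (∑ v with ¬ E v, ‖a v‖ ^ 2 + ∑ v with E v, ‖b v‖ ^ 2) ≤
      ‖1 - ∑ v, a v * conj (b v)‖ := by
  have h1 : ‖∑ v, a v * conj (b v)‖ ≤ ∑ v, (1 / 4 * ‖a v‖ ^ 2 + 1 / 4 * ‖b v‖ ^ 2 +
      3 / 4 * ((if ¬ E v then ‖a v‖ ^ 2 else 0) + if E v then ‖b v‖ ^ 2 else 0)) := by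
    refine (norm_sum_le _ _).trans (Finset.sum_le_sum fun v _ => ?_)
    rw [norm_mul, RCLike.norm_conj]
    by_cases h : E v
    · simp only [h, not_true_eq_false, if_true, if_false]
      nlinarith [sq_nonneg (‖a v‖ - 2 * ‖b v‖)]
    · simp only [h, not_false_eq_true, if_true, if_false]
      nlinarith [sq_nonneg (2 * ‖a v‖ - ‖b v‖)]
  rw [Finset.sum_add_distrib, Finset.sum_add_distrib, ← Finset.mul_sum, ← Finset.mul_sum,
    ← Finset.mul_sum, Finset.sum_add_distrib, ha, hb, ← Finset.sum_filter,
    ← Finset.sum_filter] at h1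
  have h2 := norm_sub_norm_le (1 : ℂ) (∑ v, a v * conj (b v))
  rw [norm_one] at h2
  linarith

/-! ### Inputs with at most one marked position in each of `M` blocks of length `B` -/

section Blocks

variable {M B N : ℕ}

open Classical in
/-- The function with value `h` at the marked positions; the block `j` has its `b`-th position
marked if `x j = some b`. -/
noncomputable def blockInput (e : Fin M × Fin B ↪ Fin N) (h : ℝ) (x : Fin M → Option (Fin B))
    (i : Fin N) : ℝ :=
  if ∃ t, e t = i ∧ x t.1 = some t.2 then h else 0

theorem blockInput_apply (e : Fin M × Fin B ↪ Fin N) (h : ℝ) (x : Fin M → Option (Fin B))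
    (t : Fin M × Fin B) : blockInput e h x (e t) = if x t.1 = some t.2 then h else 0 := by
  have : (∃ t', e t' = e t ∧ x t'.1 = some t'.2) ↔ x t.1 = some t.2 :=
    ⟨fun ⟨t', h, h'⟩ => e.injective h ▸ h', fun h => ⟨t, rfl, h⟩⟩
  simp only [blockInput, this]

/-- The weight of a pattern of marked positions. -/
noncomputable def blockWeight (x : Fin M → Option (Fin B)) : ℝ :=
  -- The factor `B` makes an empty block weigh as much as its `B` marked versions together.
  ∏ j, if x j = none then (B : ℝ) else 1

theorem blockWeight_nonneg (x : Fin M → Option (Fin B)) : 0 ≤ blockWeight x :=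
  Finset.prod_nonneg fun _ _ => by split_ifs <;> positivity

theorem blockWeight_update {x : Fin M → Option (Fin B)} {j : Fin M} (hj : x j ≠ none) :
    blockWeight (Function.update x j none) = B * blockWeight x := by
  unfold blockWeight
  rw [← Finset.mul_prod_erase _ _ (Finset.mem_univ j), ← Finset.mul_prod_erase _ (a := j)
    (fun i => if x i = none then (B : ℝ) else 1) (Finset.mem_univ j)]
  rw [Function.update_self, if_pos rfl, if_neg hj, one_mul]
  congr 1
  refine Finset.prod_congr rfl fun i hi => ?_
  rw [Function.update_of_ne (Finset.ne_of_mem_erase hi)]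

/-- A pattern together with one of its marked positions. -/
abbrev MarkedPattern (M B : ℕ) : Type :=
  {r : (Fin M → Option (Fin B)) × Fin M × Fin B // r.1 r.2.1 = some r.2.2}

namespace MarkedPattern

/-- Erase the distinguished marked position. -/
def erase (r : MarkedPattern M B) : Fin M → Option (Fin B) :=
  Function.update r.1.1 r.1.2.1 none

theorem sum_eq_left (F : (Fin M → Option (Fin B)) × Fin M × Fin B → ℝ) :
    ∑ r : MarkedPattern M B, F r.1 = ∑ x, ∑ t with x t.1 = some t.2, F (x, t) := by
  rw [← Finset.sum_subtype (Finset.univ.filter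
    fun r : (Fin M → Option (Fin B)) × Fin M × Fin B => r.1 r.2.1 = some r.2.2)
    (fun _ => by simp) F]
  simp only [Finset.sum_filter, Fintype.sum_prod_type (α₁ := Fin M → Option (Fin B))]

/-- Erasing the distinguished mark is undone by marking the remembered position in the empty block.
-/
theorem sum_eq_right (F : (Fin M → Option (Fin B)) × Fin M × Fin B → ℝ) :
    ∑ r : MarkedPattern M B, F (r.erase, r.1.2) = ∑ y, ∑ t with y t.1 = none, F (y, t) := by
  simp only [Finset.sum_filter, ← Fintype.sum_prod_type (α₁ := Fin M → Option (Fin B))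
    (f := fun r => if r.1 r.2.1 = none then F r else 0)]
  rw [← Finset.sum_filter]
  refine Finset.sum_bij' (fun r _ => (r.erase, r.1.2))
    (fun s _ => ⟨(Function.update s.1 s.2.1 (some s.2.2), s.2), by simp⟩) ?_ ?_ ?_ ?_ ?_
  · intro r _; simp [erase]
  · intro r _; simp
  · rintro ⟨⟨x, j, b⟩, h⟩ _
    simp only [erase, Function.update_idem, Subtype.mk.injEq, Prod.mk.injEq, and_true]
    rw [← h]
    exact Function.update_eq_self _ _
  · rintro ⟨y, j, b⟩ h
    simp only [Finset.mem_filter, Finset.mem_univ, true_and] at h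
    simp only [erase, Function.update_idem, Prod.mk.injEq, and_true]
    rw [← h]
    exact Function.update_eq_self _ _
  · intro r _; rfl

theorem blockWeight_eq (hB : 1 ≤ B) (r : MarkedPattern M B) :
    blockWeight r.1.1 = blockWeight r.erase / B := by
  have : (B : ℝ) ≠ 0 := by positivity
  rw [erase, blockWeight_update (by rw [r.2]; simp)]
  field_simp

end MarkedPattern

/-- The adversary that erases one marked position. -/
noncomputable def Adversary.block (hB : 1 ≤ B) (e : Fin M × Fin B ↪ Fin N) (h : ℝ) :
    Adversary (Fin N) ℝ (Fin M → Option (Fin B)) (MarkedPattern M B) where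
  input := blockInput e h
  left r := r.1.1
  right r := r.erase
  pos r := e r.1.2
  μ := blockWeight
  w r := blockWeight r.1.1
  -- The right pattern weighs `B` times the left one, so `w = μ (left r) = √(μ (left r) * μ (right
  -- r)) / √B`.
  κ := 1 / √B
  μ_nonneg := blockWeight_nonneg
  w_nonneg _ := blockWeight_nonneg _
  κ_nonneg := by positivity
  left_inj := by
    rintro ⟨⟨x, t⟩, _⟩ ⟨⟨x', t'⟩, _⟩ h
    simpa using h
  right_inj := by
    rintro ⟨⟨x, j, b⟩, h⟩ ⟨⟨x', j', b'⟩, h'⟩ heq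
    simp only [Prod.mk.injEq, EmbeddingLike.apply_eq_iff_eq, MarkedPattern.erase] at heq h h'
    obtain ⟨h1, rfl, rfl⟩ := heq
    have := congrArg (fun y => Function.update y j (some b)) h1
    simp only [Function.update_idem] at this
    conv at this => lhs; rw [← h, Function.update_eq_self]
    conv at this => rhs; rw [← h', Function.update_eq_self]
    subst this
    rfl
  agree := by
    rintro ⟨⟨x, j, b⟩, h⟩ i hi
    dsimp only at h hi
    simp only [blockInput, MarkedPattern.erase]
    have : ∀ t, (e t = i ∧ x t.1 = some t.2) ↔
        (e t = i ∧ Function.update x j none t.1 = some t.2) := by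
      intro t
      refine and_congr_right fun ht => ?_
      by_cases htj : t.1 = j
      · subst htj
        rw [Function.update_self, h]
        simp only [Option.some.injEq, reduceCtorEq, iff_false]
        rintro rfl
        exact hi ht.symm
      · rw [Function.update_of_ne htj]
    exact if_congr (exists_congr this) rfl rfl
  w_le r := by
    have hB' : (0 : ℝ) < B := by positivity
    have : blockWeight r.erase = B * blockWeight r.1.1 := by
      rw [MarkedPattern.blockWeight_eq hB r]; field_simp
    rw [this, show blockWeight r.1.1 * (B * blockWeight r.1.1) = B * blockWeight r.1.1 ^ 2 by ring,
      Real.sqrt_mul hB'.le, Real.sqrt_sq (blockWeight_nonneg _), ← mul_assoc, one_div,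
      inv_mul_cancel₀ (by positivity), one_mul]

-- After exchanging the sums, an outcome with at most `c` wrong positions contributes at most `c`;
-- any other contributes at most `S.card`, and these have total probability at most `1/4`.
open Classical in
theorem sum_wrong_le {Z : Type*} [Fintype Z] (P : Z → ℝ) (hP : ∀ z, 0 ≤ P z) (hP1 : ∑ z, P z = 1)
    (e : Fin M × Fin B ↪ Fin N) (wrong : Fin N → Z → Prop) {c : ℝ}
    (hc : ∑ z with c < (Finset.univ.filter fun i => wrong i z).card, P z ≤ 1 / 4) (hc0 : 0 ≤ c)
    (S : Finset (Fin M × Fin B)) :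
    ∑ t ∈ S, ∑ z with wrong (e t) z, P z ≤ c + 1 / 4 * S.card := by
  simp only [Finset.sum_filter]
  rw [Finset.sum_comm]
  have : ∀ z, ∑ t ∈ S, (if wrong (e t) z then P z else 0) ≤
      c * P z + S.card * if c < (Finset.univ.filter fun i => wrong i z).card then P z else 0 := by
    intro z
    rw [← Finset.sum_filter, Finset.sum_const, nsmul_eq_mul]
    split_ifs with h
    · have : ((S.filter fun t => wrong (e t) z).card : ℝ) ≤ S.card := by
        exact_mod_cast Finset.card_filter_le _ _
      nlinarith [hP z, mul_nonneg hc0 (hP z)]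
    · have : ((S.filter fun t => wrong (e t) z).card : ℝ) ≤
          (Finset.univ.filter fun i => wrong i z).card := by
        rw [← Finset.card_map e]
        refine Nat.cast_le.2 (Finset.card_le_card fun i hi => ?_)
        simp only [Finset.mem_map, Finset.mem_filter] at hi
        obtain ⟨t, ⟨_, ht⟩, rfl⟩ := hi
        simpa using ht
      rw [mul_zero, add_zero]
      exact mul_le_mul_of_nonneg_right (this.trans (not_lt.1 h)) (hP z)
  refine (Finset.sum_le_sum fun z _ => this z).trans ?_
  rw [Finset.sum_add_distrib, ← Finset.mul_sum, ← Finset.mul_sum, hP1, ← Finset.sum_filter]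
  nlinarith [Nat.cast_nonneg (α := ℝ) S.card]

open Classical in
/-- If the marked positions are recovered up to `M / 48` errors with probability `3 / 4`, then the
progress is of order `M`. -/
theorem Adversary.Progress.le_of_recovers (hB : 1 ≤ B) (e : Fin M × Fin B ↪ Fin N) {h : ℝ}
    {Z : Type*} [Fintype Z] {a : (Fin M → Option (Fin B)) → Z → ℂ} {c : ℝ}
    (ha : (Adversary.block hB e h).Progress a c) (φ : Z → Fin N → ℝ)
    (hφ : ∀ x, ∑ z with (M / 48 : ℝ) < (Finset.univ.filter
      fun i => h / 2 ≤ |blockInput e h x i - φ z i|).card, ‖a x z‖ ^ 2 ≤ 1 / 4) :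
    (M / 32 : ℝ) ≤ c := by
  have hB' : (0 : ℝ) < B := by positivity
  have hB1 : (1 : ℝ) ≤ B := by exact_mod_cast hB
  set err : (Fin M → Option (Fin B)) → Fin M × Fin B → ℝ := fun x t =>
    ∑ z with h / 2 ≤ |blockInput e h x (e t) - φ z (e t)|, ‖a x z‖ ^ 2 with herr
  have herr_le : ∀ x (S : Finset (Fin M × Fin B)), ∑ t ∈ S, err x t ≤ M / 48 + 1 / 4 * S.card :=
    fun x S => sum_wrong_le _ (fun z => sq_nonneg _) (ha.norm_eq x) e
      (fun i z => h / 2 ≤ |blockInput e h x i - φ z i|) (hφ x) (by positivity) S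
  set T : ℝ := ∑ x : Fin M → Option (Fin B), blockWeight x with hT
  have hTpos : 0 < T := by
    refine Finset.sum_pos (fun x _ => Finset.prod_pos fun j _ => ?_) Finset.univ_nonempty
    split_ifs <;> positivity
  set W : ℝ := ∑ r : MarkedPattern M B, blockWeight r.1.1 with hW
  set S₀ : (Fin M → Option (Fin B)) → Finset (Fin M × Fin B) :=
    fun x => Finset.univ.filter fun t => x t.1 = none with hS₀
  set S₁ : (Fin M → Option (Fin B)) → Finset (Fin M × Fin B) :=
    fun x => Finset.univ.filter fun t => x t.1 = some t.2 with hS₁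
  have hW₁ : W = ∑ x, blockWeight x * (S₁ x).card := by
    rw [hW, MarkedPattern.sum_eq_left fun s => blockWeight s.1]
    simp only [Finset.sum_const, nsmul_eq_mul, mul_comm, hS₁]
  have hW₀ : W = ∑ y, blockWeight y / B * (S₀ y).card := by
    rw [hW]
    simp only [MarkedPattern.blockWeight_eq hB]
    rw [MarkedPattern.sum_eq_right fun s => blockWeight s.1 / B]
    simp only [Finset.sum_const, nsmul_eq_mul, mul_comm, hS₀]
  -- An empty block contributes its `B` positions to `S₀ x`, a marked block one position to `S₁ x`.
  have hcard : ∀ x, ((S₀ x).card : ℝ) / B + (S₁ x).card = M := by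
    intro x
    have h0 : (S₀ x).card = (Finset.univ.filter fun j => x j = none).card * B := by
      have : S₀ x = (Finset.univ.filter fun j => x j = none) ×ˢ Finset.univ := by
        ext t; simp [hS₀]
      rw [this, Finset.card_product, Finset.card_univ, Fintype.card_fin]
    have h1 : (S₁ x).card = (Finset.univ.filter fun j => ¬ x j = none).card := by
      refine Finset.card_bij (fun t _ => t.1) ?_ ?_ ?_
      · intro t ht
        simp only [hS₁, Finset.mem_filter, Finset.mem_univ, true_and] at ht
        simp [ht]
      · rintro ⟨j, b⟩ ht ⟨j', b'⟩ ht' hj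
        simp only [hS₁, Finset.mem_filter, Finset.mem_univ, true_and] at ht ht' hj
        subst hj
        rw [ht] at ht'
        simp_all
      · intro j hj
        obtain ⟨b, hb⟩ := Option.ne_none_iff_exists'.1 (Finset.mem_filter.1 hj).2
        exact ⟨(j, b), by simp [hS₁, hb], rfl⟩
    have h2 := Finset.card_filter_add_card_filter_not (s := (Finset.univ : Finset (Fin M)))
      fun j => x j = none
    rw [Finset.card_univ, Fintype.card_fin] at h2
    rw [h0, h1, Nat.cast_mul, mul_div_cancel_right₀ _ hB'.ne']
    exact_mod_cast h2
  have hWT : 2 * W = T * M := by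
    rw [two_mul]
    nth_rw 1 [hW₀]
    rw [hW₁, ← Finset.sum_add_distrib, hT, Finset.sum_mul]
    refine Finset.sum_congr rfl fun x _ => ?_
    rw [← hcard x]
    ring
  have hleft : ∑ r : MarkedPattern M B, blockWeight r.1.1 * err r.1.1 r.1.2 ≤
      T * (M / 48) + 1 / 4 * W := by
    rw [MarkedPattern.sum_eq_left fun s => blockWeight s.1 * err s.1 s.2, hW₁, hT, Finset.sum_mul,
      Finset.mul_sum, ← Finset.sum_add_distrib]
    refine Finset.sum_le_sum fun x _ => ?_
    simp only [← Finset.mul_sum]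
    refine (mul_le_mul_of_nonneg_left (herr_le x (S₁ x)) (blockWeight_nonneg x)).trans
      (le_of_eq (by ring))
  have hright : ∑ r : MarkedPattern M B, blockWeight r.1.1 * err r.erase r.1.2 ≤
      T * (M / 48) + 1 / 4 * W := by
    simp only [MarkedPattern.blockWeight_eq hB]
    rw [MarkedPattern.sum_eq_right fun s => blockWeight s.1 / B * err s.1 s.2, hW₀, hT,
      Finset.sum_mul, Finset.mul_sum, ← Finset.sum_add_distrib]
    refine Finset.sum_le_sum fun y _ => ?_
    simp only [← Finset.mul_sum]
    have h0 := blockWeight_nonneg y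
    refine (mul_le_mul_of_nonneg_left (herr_le y (S₀ y)) (by positivity)).trans ?_
    rw [mul_add]
    refine add_le_add (mul_le_mul_of_nonneg_right (div_le_self h0 hB1) (by positivity))
      (le_of_eq (by ring))
  have hsum : ∑ r : MarkedPattern M B, blockWeight r.1.1 *
      (1 / 2 - 3 / 4 * (err r.1.1 r.1.2 + err r.erase r.1.2)) ≤ c * T := by
    have := ha.le (fun _ => 1) fun _ => zero_le_one
    simp only [mul_one, one_pow] at this
    refine le_trans (Finset.sum_le_sum fun r _ => mul_le_mul_of_nonneg_left ?_
      (blockWeight_nonneg _)) this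
    -- The test asks whether the output at the erased position is at least `h/2` in absolute value;
    -- if it is not, the output is wrong by at least `h/2` for the marked input.
    refine le_trans ?_ (half_sub_le_norm_one_sub_inner _ _ (ha.norm_eq _) (ha.norm_eq _)
      fun z => h / 2 ≤ |blockInput e h r.erase (e r.1.2) - φ z (e r.1.2)|)
    refine sub_le_sub_left (mul_le_mul_of_nonneg_left (add_le_add ?_ le_rfl) (by norm_num)) _
    refine Finset.sum_le_sum_of_subset_of_nonneg ?_ fun _ _ _ => sq_nonneg _
    intro z hz
    simp only [Finset.mem_filter, Finset.mem_univ, true_and, not_le] at hz ⊢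
    have e1 : blockInput e h r.1.1 (e r.1.2) = h := by
      rw [blockInput_apply, if_pos r.2]
    have e2 : blockInput e h r.erase (e r.1.2) = 0 := by
      rw [blockInput_apply, if_neg (by simp [MarkedPattern.erase])]
    rw [e2, zero_sub, abs_neg] at hz
    rw [e1]
    refine le_trans ?_ (le_abs_self _)
    linarith [le_abs_self (φ z (e r.1.2))]
  have hexp : ∑ r : MarkedPattern M B, blockWeight r.1.1 *
      (1 / 2 - 3 / 4 * (err r.1.1 r.1.2 + err r.erase r.1.2)) = 1 / 2 * W -
      3 / 4 * (∑ r : MarkedPattern M B, blockWeight r.1.1 * err r.1.1 r.1.2 +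
        ∑ r : MarkedPattern M B, blockWeight r.1.1 * err r.erase r.1.2) := by
    rw [hW, Finset.mul_sum, ← Finset.sum_add_distrib, Finset.mul_sum, ← Finset.sum_sub_distrib]
    refine Finset.sum_congr rfl fun r _ => ?_
    ring
  -- With `2W = TM` the lower bound is `W/2 - (3/4)(2TM/48 + W/2) = W/8 - TM/32 = TM/32`.
  have : T * (M / 32) ≤ T * c := by nlinarith
  exact le_of_mul_le_mul_left this hTpos

end Blocks

/-! ### Norms of the block inputs and the resulting error bound. -/

theorem lpNNorm_blockInput_le (p : ℝ≥0∞) [Fact (1 ≤ p)] {M B N : ℕ} (hM : 1 ≤ M) (hN : 1 ≤ N)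
    (e : Fin M × Fin B ↪ Fin N) (x : Fin M → Option (Fin B)) :
    lpNNorm p (blockInput e (((N : ℝ) / M) ^ (1 / p.toReal)) x) ≤ 1 := by
  classical
  have hN' : (0 : ℝ) < N := by positivity
  have hM' : (0 : ℝ) < M := by positivity
  set h := ((N : ℝ) / M) ^ (1 / p.toReal) with hh
  have h0 : 0 ≤ h := by positivity
  unfold lpNNorm
  split_ifs with hp
  · have h1 : h = 1 := by rw [hh, hp]; simp
    have : Nonempty (Fin N) := ⟨⟨0, hN⟩⟩
    refine ciSup_le fun i => ?_
    unfold blockInput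
    split_ifs <;> simp [h1]
  · have hpos : 0 < p.toReal := ENNReal.toReal_pos (zero_lt_one.trans_le Fact.out).ne' hp
    have hpow : h ^ p.toReal = N / M := by
      rw [hh, ← Real.rpow_mul (by positivity), one_div, inv_mul_cancel₀ hpos.ne', Real.rpow_one]
    have hsum : ∑ i, |blockInput e h x i| ^ p.toReal ≤ N := by
      have h1 : ∀ i, |blockInput e h x i| ^ p.toReal =
          if ∃ t, e t = i ∧ x t.1 = some t.2 then (N / M : ℝ) else 0 := by
        intro i
        unfold blockInput
        split_ifs
        · rw [abs_of_nonneg h0, hpow]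
        · rw [abs_zero, Real.zero_rpow hpos.ne']
      simp only [h1]
      rw [← Finset.sum_filter, Finset.sum_const, nsmul_eq_mul]
      -- A marked position is determined by its block, so there are at most `M` of them.
      have hc : (Finset.univ.filter fun i => ∃ t, e t = i ∧ x t.1 = some t.2).card ≤ M := by
        have : ∀ i ∈ Finset.univ.filter fun i => ∃ t, e t = i ∧ x t.1 = some t.2,
            ∃ j : Fin M, ∃ t, e t = i ∧ x t.1 = some t.2 ∧ t.1 = j := by
          intro i hi
          obtain ⟨t, ht⟩ := (Finset.mem_filter.1 hi).2
          exact ⟨t.1, t, ht.1, ht.2, rfl⟩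
        choose g hg using this
        have := Finset.card_le_card_of_injOn (s := (Finset.univ.filter
            fun i => ∃ t, e t = i ∧ x t.1 = some t.2).attach) (t := Finset.univ)
          (fun i => g i.1 i.2) (fun _ _ => Finset.mem_coe.2 (Finset.mem_univ _)) ?_
        · simpa using this
        · intro i _ i' _ hii
          obtain ⟨⟨j, b⟩, h1, h2, h3⟩ := hg i.1 i.2
          obtain ⟨⟨j', b'⟩, h1', h2', h3'⟩ := hg i'.1 i'.2
          dsimp only at h2 h3 h2' h3' hii
          rw [← hii, ← h3] at h3'
          subst h3'
          rw [h2, Option.some.injEq] at h2'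
          subst h2'
          exact Subtype.ext (h1.symm.trans h1')
      have hc' : ((Finset.univ.filter fun i => ∃ t, e t = i ∧ x t.1 = some t.2).card : ℝ) ≤ M := by
        exact_mod_cast hc
      calc _ ≤ (M : ℝ) * (N / M) := mul_le_mul_of_nonneg_right hc' (by positivity)
        _ = N := by field_simp
    refine Real.rpow_le_one (by positivity) ?_ (by positivity)
    rw [one_div, inv_mul_le_iff₀ hN', mul_one]
    exact hsum

theorem le_lpNNorm_of_card (q : ℝ≥0∞) [Fact (1 ≤ q)] {M N : ℕ} (hM : 1 ≤ M) (hN : 1 ≤ N)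
    {h : ℝ} (h0 : 0 ≤ h) (f : Fin N → ℝ)
    (hf : (M / 48 : ℝ) < (Finset.univ.filter fun i => h / 2 ≤ |f i|).card) :
    1 / 96 * (h * ((N : ℝ) / M) ^ (-(1 / q.toReal))) ≤ lpNNorm q f := by
  have hN' : (0 : ℝ) < N := by positivity
  have hM' : (0 : ℝ) < M := by positivity
  unfold lpNNorm
  split_ifs with hq
  · have hpos : 0 < (Finset.univ.filter fun i => h / 2 ≤ |f i|).card := by
      have : (0 : ℝ) < (Finset.univ.filter fun i => h / 2 ≤ |f i|).card :=
        lt_trans (by positivity) hf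
      exact_mod_cast this
    obtain ⟨i, hi⟩ := Finset.card_pos.1 hpos
    refine le_trans ?_ (le_ciSup (f := fun i => |f i|) (Set.finite_range _).bddAbove i)
    have := (Finset.mem_filter.1 hi).2
    simp only [hq, ENNReal.toReal_top, div_zero, neg_zero, Real.rpow_zero]
    linarith
  · have h1q : 1 ≤ q.toReal := by
      have := ENNReal.toReal_mono hq (Fact.out : 1 ≤ q)
      simpa using this
    have hpos : 0 < q.toReal := by linarith
    have hsum : (M / 48 : ℝ) * (h / 2) ^ q.toReal ≤ ∑ i, |f i| ^ q.toReal := by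
      calc _ ≤ ∑ i with h / 2 ≤ |f i|, (h / 2) ^ q.toReal := by
            rw [Finset.sum_const, nsmul_eq_mul]
            exact mul_le_mul_of_nonneg_right hf.le (by positivity)
        _ ≤ ∑ i with h / 2 ≤ |f i|, |f i| ^ q.toReal :=
            Finset.sum_le_sum fun i hi => Real.rpow_le_rpow (by positivity)
              (Finset.mem_filter.1 hi).2 hpos.le
        _ ≤ _ := Finset.sum_le_sum_of_subset_of_nonneg (Finset.filter_subset _ _)
              fun _ _ _ => by positivity
    have hle : ((1 / 48 : ℝ) * (M / N) * (h / 2) ^ q.toReal) ^ (1 / q.toReal) ≤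
        (1 / (N : ℝ) * ∑ i, |f i| ^ q.toReal) ^ (1 / q.toReal) := by
      refine Real.rpow_le_rpow (by positivity) ?_ (by positivity)
      calc _ = 1 / (N : ℝ) * ((M / 48 : ℝ) * (h / 2) ^ q.toReal) := by ring
        _ ≤ _ := mul_le_mul_of_nonneg_left hsum (by positivity)
    refine le_trans ?_ hle
    rw [Real.mul_rpow (by positivity) (by positivity), Real.mul_rpow (by positivity)
      (by positivity), ← Real.rpow_mul (by positivity), mul_one_div_cancel hpos.ne', Real.rpow_one,
      Real.rpow_neg (by positivity), ← Real.inv_rpow (by positivity), inv_div]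
    -- As `q ≥ 1`, replacing `(1/48)^(1/q)` by `1/48` only loses; together with `h/2` this gives
    -- `1/96` for every `q`.
    have h48 : (1 / 48 : ℝ) ≤ (1 / 48) ^ (1 / q.toReal) := by
      conv_lhs => rw [← Real.rpow_one (1 / 48 : ℝ)]
      exact Real.rpow_le_rpow_of_exponent_ge (by norm_num) (by norm_num)
        ((div_le_one hpos).2 h1q)
    calc _ = 1 / 48 * ((M / N : ℝ) ^ (1 / q.toReal) * (h / 2)) := by ring
      _ ≤ (1 / 48) ^ (1 / q.toReal) * ((M / N : ℝ) ^ (1 / q.toReal) * (h / 2)) :=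
          mul_le_mul_of_nonneg_right h48 (by positivity)
      _ = _ := by ring

/-- An algorithm with smaller error would recover all block patterns up to `M/48` wrong positions,
so `M/32 ≤ 2n/√B`, contrary to `hn`. -/
theorem le_minQueryError_embJBall (p q : ℝ≥0∞) [Fact (1 ≤ p)] [Fact (1 ≤ q)] {M B N n : ℕ}
    (hM : 1 ≤ M) (hB : 1 ≤ B) (hMB : M * B ≤ N) (hn : 64 * (n : ℝ) < M * √B) :
    ENNReal.ofReal (1 / 96 * ((N : ℝ) / M) ^ (1 / p.toReal - 1 / q.toReal)) ≤
      minQueryError n (embJBall p q N) := by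
  classical
  have hN : 1 ≤ N := (Nat.mul_pos hM hB).trans_le hMB
  have hNM : (0 : ℝ) < (N : ℝ) / M := by positivity
  set h := ((N : ℝ) / M) ^ (1 / p.toReal) with hh
  have h0 : 0 ≤ h := by positivity
  set E := 1 / 96 * ((N : ℝ) / M) ^ (1 / p.toReal - 1 / q.toReal) with hE
  have hEh : E = 1 / 96 * (h * ((N : ℝ) / M) ^ (-(1 / q.toReal))) := by
    rw [hE, sub_eq_add_neg, Real.rpow_add hNM]
  let e : Fin M × Fin B ↪ Fin N := finProdFinEquiv.toEmbedding.trans (Fin.castLEEmb hMB)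
  by_contra hcon
  rw [not_le, minQueryError, minQueryErrorAt] at hcon
  simp only [iInf_lt_iff] at hcon
  obtain ⟨A, hAn, hA⟩ := hcon
  have key := Adversary.Progress.le_of_recovers hB e (A.progress (Adversary.block hB e h))
    (fun z => A.φ z) ?_
  · have hBs : 0 < √(B : ℝ) := by positivity
    have hAn' : (A.numQueries : ℝ) ≤ n := by exact_mod_cast hAn
    change (M / 32 : ℝ) ≤ 2 * (1 / √B) * A.numQueries at key
    have : (M / 32 : ℝ) * √B ≤ 2 * A.numQueries := by
      calc _ ≤ 2 * (1 / √B) * A.numQueries * √B := mul_le_mul_of_nonneg_right key hBs.le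
        _ = _ := by field_simp
    linarith
  · intro x
    have hx : blockInput e h x ∈ ballLpN p N := lpNNorm_blockInput_le p hM hN e x
    have hlt := (le_iSup (fun f : ballLpN p N => A.errorAt (embJBall p q N f) f.1 (1 / 4))
      ⟨_, hx⟩).trans_lt hA
    simp only [QAlgorithm.errorAt, iInf_lt_iff] at hlt
    obtain ⟨ε, hε, hεE⟩ := hlt
    have hεE' : (ε : ℝ) < E := by
      rw [← ENNReal.ofReal_coe_nnreal] at hεE
      exact ENNReal.lt_ofReal_iff_toReal_lt (by simp) |>.1 hεE |> fun h => by simpa using h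
    refine le_trans ?_ hε
    unfold QAlgorithm.output
    simp only [QAlgorithm.prob_eq]
    refine Finset.sum_le_sum_of_subset_of_nonneg ?_ fun _ _ _ => sq_nonneg _
    intro z hz
    simp only [Finset.mem_filter, Finset.mem_univ, true_and, Set.mem_ofPred_eq] at hz ⊢
    refine hεE'.trans_le ?_
    rw [hEh]
    exact le_lpNNorm_of_card q hM hN h0 _ hz

/-! ### Choice of the block parameters and conclusion. -/

theorem one_div_toReal_le_one (p : ℝ≥0∞) [hp : Fact (1 ≤ p)] : 1 / p.toReal ≤ 1 := by
  rcases eq_or_ne p ∞ with rfl | h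
  · simp
  · have : 1 ≤ p.toReal := by simpa using ENNReal.toReal_mono h hp.out
    exact (div_le_one (by linarith)).2 this

theorem one_div_toReal_anti {p q : ℝ≥0∞} [hp : Fact (1 ≤ p)] (h : p ≤ q) :
    1 / q.toReal ≤ 1 / p.toReal := by
  rcases eq_or_ne q ∞ with rfl | hq
  · simp
  · have hp' : 1 ≤ p.toReal := by
      simpa using ENNReal.toReal_mono (ne_top_of_le_ne_top hq h) hp.out
    exact one_div_le_one_div_of_le (by linarith) (ENNReal.toReal_mono hq h)

/-- Since `M * ⌊N/M⌋ ≥ N/2`, the query condition follows from `M * N > 8192 n²`. The least natural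
number `M` with this property is chosen, and `n ≤ N/128` keeps it at most `N`. -/
theorem exists_blocks {n N : ℕ} (hn : 1 ≤ n) (hN : 1 ≤ N) (hnN : (n : ℝ) ≤ 1 / 128 * N) :
    ∃ M B : ℕ, 1 ≤ M ∧ 1 ≤ B ∧ M * B ≤ N ∧ 64 * (n : ℝ) < M * √B ∧
      1 / 16384 * min (((N : ℝ) / n) ^ 2) N ≤ N / M := by
  have hn' : (1 : ℝ) ≤ n := by exact_mod_cast hn
  have hN' : (0 : ℝ) < N := by positivity
  set y : ℝ := 8192 * n ^ 2 / N with hy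
  have hy0 : 0 < y := by positivity
  have hyN : y ≤ N / 2 := by
    rw [hy, div_le_iff₀ hN']
    nlinarith
  set M := ⌊y⌋₊ + 1 with hM
  have hMy : y < M := by rw [hM]; push_cast; exact Nat.lt_floor_add_one y
  have hMy' : (M : ℝ) ≤ y + 1 := by
    rw [hM]; push_cast; linarith [Nat.floor_le hy0.le]
  have hMN : (M : ℝ) ≤ N := by linarith
  have hMN' : M ≤ N := by exact_mod_cast hMN
  have hM1 : 1 ≤ M := Nat.succ_pos _
  have hM0 : (0 : ℝ) < M := by positivity
  have hB1 : 1 ≤ N / M := (Nat.one_le_div_iff hM1).2 hMN'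
  refine ⟨M, N / M, hM1, hB1, Nat.mul_div_le N M, ?_, ?_⟩
  · have hBN : (N : ℝ) ≤ 2 * (M * (N / M : ℕ)) := by
      have h1 : N < M * (N / M) + M := Nat.lt_mul_div_succ N hM1
      have h2 : M ≤ M * (N / M) := Nat.le_mul_of_pos_right _ hB1
      exact_mod_cast (by omega : N ≤ 2 * (M * (N / M)))
    refine lt_of_pow_lt_pow_left₀ 2 (by positivity) ?_
    rw [mul_pow, mul_pow, Real.sq_sqrt (by positivity)]
    have h3 : 8192 * (n : ℝ) ^ 2 < M * N := by rwa [hy, div_lt_iff₀ hN'] at hMy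
    nlinarith
  · rw [le_div_iff₀ hM0]
    -- Either `M ≤ 2`, which yields the term `N` of the minimum, or `M ≤ 2y`, which yields `(N/n)²`.
    rcases le_total y 1 with h | h
    · have : (M : ℝ) ≤ 2 := by linarith
      have h4 := min_le_right (((N : ℝ) / n) ^ 2) N
      have h5 : 0 ≤ min (((N : ℝ) / n) ^ 2) N := by positivity
      nlinarith
    · have : (M : ℝ) ≤ 2 * y := by linarith
      have h4 := min_le_left (((N : ℝ) / n) ^ 2) N
      have h5 : 0 ≤ min (((N : ℝ) / n) ^ 2) N := by positivity
      calc _ ≤ 1 / 16384 * ((N : ℝ) / n) ^ 2 * (2 * y) := by gcongr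
        _ = N := by rw [hy]; field_simp; norm_num

theorem proposition5 (p q : ℝ≥0∞) [Fact (1 ≤ p)] [Fact (1 ≤ q)] :
    ∃ c₀ c₁ : ℝ, 0 < c₀ ∧ 0 < c₁ ∧
      ∀ n N : ℕ, 1 ≤ n → 1 ≤ N → (n : ℝ) ≤ c₀ * N →
        (p ≤ q →
          ENNReal.ofReal (c₁ * min
            (((N : ℝ) / n) ^ (2 / p.toReal - 2 / q.toReal)
              * (Real.logb 2 ((n : ℝ) / √(N : ℝ) + 2)) ^ (-(2 / q.toReal)))
            ((N : ℝ) ^ (1 / p.toReal - 1 / q.toReal)))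
          ≤ minQueryError n (embJBall p q N)) ∧
        (q < p →
          ENNReal.ofReal (c₁ * (Real.logb 2 (N : ℝ) + 1) ^ (-(2 / q.toReal)))
          ≤ minQueryError n (embJBall p q N)) := by
  refine ⟨1 / 128, 1 / 96 * (1 / 16384), by norm_num, by norm_num, fun n N hn hN hnN => ?_⟩
  have hN' : (0 : ℝ) < N := by positivity
  have hq0 : 0 ≤ 2 / q.toReal := by positivity
  refine ⟨fun hpq => ?_, fun _ => ?_⟩
  · obtain ⟨M, B, hM, hB, hMB, hlt, hmin⟩ := exists_blocks hn hN hnN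
    refine (ENNReal.ofReal_le_ofReal ?_).trans (le_minQueryError_embJBall p q hM hB hMB hlt)
    set a := 1 / p.toReal - 1 / q.toReal with ha
    have ha0 : 0 ≤ a := sub_nonneg.2 (one_div_toReal_anti hpq)
    have ha1 : a ≤ 1 := by
      have := one_div_toReal_le_one p
      have : 0 ≤ 1 / q.toReal := by positivity
      linarith
    -- The logarithm is at least 1 thanks to the summand 2, so its nonpositive power can be dropped.
    have hlog : (Real.logb 2 ((n : ℝ) / √(N : ℝ) + 2)) ^ (-(2 / q.toReal)) ≤ 1 := by
      refine Real.rpow_le_one_of_one_le_of_nonpos ?_ (by linarith)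
      rw [Real.le_logb_iff_rpow_le (by norm_num) (by positivity), Real.rpow_one]
      have : 0 ≤ (n : ℝ) / √(N : ℝ) := by positivity
      linarith
    rw [mul_assoc]
    refine mul_le_mul_of_nonneg_left ?_ (by norm_num)
    have h2a : 2 / p.toReal - 2 / q.toReal = 2 * a := by rw [ha]; ring
    have hNn : 0 ≤ (N : ℝ) / n := by positivity
    calc _ ≤ 1 / 16384 * min ((((N : ℝ) / n) ^ 2) ^ a) ((N : ℝ) ^ a) := by
          refine mul_le_mul_of_nonneg_left (min_le_min ?_ le_rfl) (by norm_num)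
          rw [h2a, Real.rpow_mul hNn, Real.rpow_two]
          exact mul_le_of_le_one_right (by positivity) hlog
      _ ≤ (1 / 16384) ^ a * (min (((N : ℝ) / n) ^ 2) N) ^ a := by
          refine mul_le_mul ?_ ?_ (by positivity) (by positivity)
          · conv_lhs => rw [← Real.rpow_one (1 / 16384 : ℝ)]
            exact Real.rpow_le_rpow_of_exponent_ge (by norm_num) (by norm_num) ha1
          · rcases le_total (((N : ℝ) / n) ^ 2) N with h | h
            · rw [min_eq_left h]; exact min_le_left _ _
            · rw [min_eq_right h]; exact min_le_right _ _
      _ = (1 / 16384 * min (((N : ℝ) / n) ^ 2) N) ^ a :=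
          (Real.mul_rpow (by norm_num) (by positivity)).symm
      _ ≤ _ := Real.rpow_le_rpow (by positivity) hmin ha0
  -- Blocks of length 1 with `M = N` make the ratio `N/M` equal to 1, which leaves the constant
  -- bound `1/96`.
  · have hlt : 64 * (n : ℝ) < N * √((1 : ℕ) : ℝ) := by
      rw [Nat.cast_one, Real.sqrt_one]
      linarith
    refine (ENNReal.ofReal_le_ofReal ?_).trans
      (le_minQueryError_embJBall p q hN le_rfl (mul_one N).le hlt)
    rw [div_self hN'.ne', Real.one_rpow]
    have hlog : (Real.logb 2 (N : ℝ) + 1) ^ (-(2 / q.toReal)) ≤ 1 := by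
      refine Real.rpow_le_one_of_one_le_of_nonpos ?_ (by linarith)
      have := Real.logb_nonneg (b := 2) (by norm_num) (Nat.one_le_cast.2 hN : (1 : ℝ) ≤ N)
      linarith
    have := Real.rpow_nonneg (add_nonneg (Real.logb_nonneg (b := 2) (by norm_num)
      (Nat.one_le_cast.2 hN : (1 : ℝ) ≤ N)) zero_le_one) (-(2 / q.toReal))
    linarith
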